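/- Let $S$ be a subset of an additive abelian group (for example $S\subseteq\mathbb{R}^d$, or $S\subseteq\mathbb{R}^d\times\mathbb{R}_+$), and let $Z=\{Z(s),s\in S\}$ be a stationary real Gaussian process with zero mean, unit variance and correlation function $\rho(h)=\operatorname{cor}(Z(s+h),Z(s))$, $s,s+h\in S$. Let $Z_1,Z_2$ be independent copies of $Z$, let $X_2(s)=\big(Z_1(s)^2+Z_2(s)^2\big)/2$, and for $\kappa>0$ let $$W(s)=\nu(\kappa)\,X_2(s)^{1/\kappa},\qquad \nu(\kappa)=\frac{1}{\Gamma(1+1/\kappa)},\qquad s\in S.$$ Write ${}_2F_1(\alpha,\beta;\gamma;x)=\sum_{k\ge 0}\frac{(\alpha)_k(\beta)_k}{(\gamma)_k}\frac{x^k}{k!}$, where $(\alpha)_k=\alpha(\alpha+1)\cdots(\alpha+k-1)$. (i) Let $s_1,s_2\in S$, $W_1=W(s_1)$, $W_2=W(s_2)$, $\rho=\rho(s_1-s_2)$, and let $a,b>-\kappa$ be real numbers; if $\rho^2=1$, suppose also that $a+b>-\kappa$. Then $W_1^aW_2^b$ is integrable, the hypergeometric series below converges absolutely, and $$\mathbb{E}\big(W_1^a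 W_2^b\big)=\frac{\Gamma(1+a/\kappa)\,\Gamma(1+b/\kappa)}{\Gamma(1+1/\kappa)^{a+b}}\;{}_2F_1\!\left(-\frac a\kappa,-\frac b\kappa;1;\rho^2\right).$$ (ii) Consequently, $W(s)$ has finite positive variance for every $s\in S$, and the correlation function $\rho_W(h)=\operatorname{cor}(W(s+h),W(s))$ of $W$ depends on the lag $h$ only (for $s,s+h\in S$) and is $$\rho_W(h)=\frac{\nu^{-2}(\kappa)}{\Gamma(1+2/\kappa)-\nu^{-2}(\kappa)}\left[{}_2F_1\!\left(-\frac1\kappa,-\frac1\kappa;1;\rho^2(h)\right)-1\right].$$ -/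

import Mathlib

open MeasureTheory ProbabilityTheory

namespace WeibullField

/-- Pearson correlation of two real random variables. -/
noncomputable def correlation {Ω : Type*} [MeasurableSpace Ω] (X Y : Ω → ℝ) (P : Measure Ω) : ℝ :=
  covariance X Y P / (√(variance X P) * √(variance Y P))

/-- The process `X`, indexed by the points of `S`, has finite positive variances, and
`cor (X (s + h), X s)` depends on the lag `h` only, being equal to `r h`
whenever `s` and `s + h` are in `S`. -/
structure HasCorrelationFunction {E Ω : Type*} [AddCommGroup E] {S : Set E} [MeasurableSpace Ω]
    (X : S → Ω → ℝ) (r : E → ℝ) (P : Measure Ω) : Prop where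
  memLp_two : ∀ s, MemLp (X s) 2 P
  variance_pos : ∀ s, 0 < variance (X s) P
  correlation_eq : ∀ (s : S) (h : E) (hs : (s : E) + h ∈ S),
    correlation (X ⟨s + h, hs⟩) (X s) P = r h

/-- A stationary Gaussian process on `S` with zero mean, unit variance and correlation function
`ρ`. (For a Gaussian process, constant mean and a covariance that depends on the lag only amount
to stationarity of all finite dimensional distributions.) -/
structure IsParentProcess {E Ω : Type*} [AddCommGroup E] {S : Set E} [MeasurableSpace Ω]
    (Z : S → Ω → ℝ) (ρ : E → ℝ) (P : Measure Ω) : Prop where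
  isGaussianProcess : IsGaussianProcess Z P
  mean_eq_zero : ∀ s, ∫ ω, Z s ω ∂P = 0
  variance_eq_one : ∀ s, variance (Z s) P = 1
  hasCorrelationFunction : HasCorrelationFunction Z ρ P

/-- `Zc 0, …, Zc (m - 1)` are independent copies of the process `Z`: each has the finite
dimensional distributions of `Z`, and they are mutually independent as processes.
The copies may live on another probability space than `Z`. -/
structure IsIndependentCopies {T Ω₀ Ω : Type*} [MeasurableSpace Ω₀] [MeasurableSpace Ω] {m : ℕ}
    (Zc : Fin m → T → Ω → ℝ) (P : Measure Ω) (Z : T → Ω₀ → ℝ) (P₀ : Measure Ω₀) : Prop where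
  identDistrib : ∀ (k : Fin m) (I : Finset T),
    IdentDistrib (fun ω ↦ I.restrict (Zc k · ω)) (fun ω ↦ I.restrict (Z · ω)) P P₀
  iIndepFun : iIndepFun (fun k ω (t : T) ↦ Zc k t ω) P

/-- The scaled `χ²` process `X_m (s) = ∑ k, Z_k (s) ^ 2 / m`. -/
noncomputable def scaledChiSq {T Ω : Type*} {m : ℕ} (Zc : Fin m → T → Ω → ℝ) (s : T) (ω : Ω) : ℝ :=
  ∑ k, Zc k s ω ^ 2 / (m : ℝ)

/-- `ν(κ) = 1 / Γ(1 + 1/κ)`. -/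
noncomputable def nu (κ : ℝ) : ℝ := (Real.Gamma (1 + 1 / κ))⁻¹

/-- The Weibull process `W (s) = ν(κ) X_2 (s) ^ (1/κ)`. -/
noncomputable def weibull {T Ω : Type*} (κ : ℝ) (Zc : Fin 2 → T → Ω → ℝ) (s : T) (ω : Ω) : ℝ :=
  nu κ * scaledChiSq Zc s ω ^ (1 / κ)

end WeibullField

namespace WeibullField

open Filter Topology PowerSeries

/-! Up to the factor `ν(κ)` and the exponent `1/κ`, `W` at two sites is a function of half the
squared norms of two planar Gaussian vectors, `u` at `s₁` and `w` at `s₂`. Given `u`, the vector `w`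
is Gaussian with mean `ρ u` and covariance `(1 - ρ²) I`. Half of `|u|²` is standard exponential.
Given `u`, half of `|w|²` has a noncentral chi-square density, a power series that arises from the
angular integral of the Gaussian density in polar coordinates
(`lintegral_half_norm_sq_gaussianReal_prod`). When `ρ² < 1`, integrating term by term against `x ^ a
* y ^ b` yields Gamma integrals that sum to `Γ(1+a) Γ(1+b) (1-ρ²)^(1+a+b) ₂F₁(1+a, 1+b; 1; ρ²)`.
Euler's transformation turns this into the claimed form (`lintegral_mixed_moment`).

When `ρ² = 1` there is no conditional density: `w = ρ u`, both norms agree, and the moment is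
`Γ(1+a+b)`. The claim is then Gauss's summation theorem (`tsum_risingCoeff_mul_eq_gamma`), obtained
by letting `x` tend to `1` in Euler's transformation.

Moments are computed as Lebesgue integrals of nonnegative functions, so Tonelli justifies every
interchange and integrability follows from finiteness. Part (ii) uses the exponents `(1, 0)`, `(2,
0)` and `(1, 1)`. -/

/-- The coefficient `(s)_k / k!` of `x ^ k` in the expansion of `(1 - x) ^ (-s)`. -/
noncomputable def risingCoeff (s : ℝ) (k : ℕ) : ℝ :=
  (ascPochhammer ℝ k).eval s / (k.factorial : ℝ)

@[simp]
lemma risingCoeff_zero (s : ℝ) : risingCoeff s 0 = 1 := by simp [risingCoeff]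

lemma risingCoeff_succ (s : ℝ) (k : ℕ) :
    risingCoeff s (k + 1) = (s + k) / (k + 1) * risingCoeff s k := by
  rw [risingCoeff, risingCoeff, ascPochhammer_succ_eval, Nat.factorial_succ]
  push_cast
  have : (k.factorial : ℝ) ≠ 0 := by positivity
  field_simp

lemma risingCoeff_pos {s : ℝ} (hs : 0 < s) (k : ℕ) : 0 < risingCoeff s k := by
  induction k with
  | zero => simp
  | succ k ih => rw [risingCoeff_succ]; positivity

lemma risingCoeff_one (k : ℕ) : risingCoeff 1 k = 1 := by
  rw [risingCoeff, ascPochhammer_eval_one, div_self (by positivity)]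

lemma risingCoeff_zero_left (k : ℕ) : risingCoeff 0 (k + 1) = 0 := by
  induction k with
  | zero => simp [risingCoeff_succ]
  | succ k ih => rw [risingCoeff_succ, ih, mul_zero]

lemma ordinaryHypergeometricCoefficient_one (a b : ℝ) (k : ℕ) :
    ordinaryHypergeometricCoefficient a b 1 k = risingCoeff a k * risingCoeff b k := by
  rw [ordinaryHypergeometricCoefficient, ascPochhammer_eval_one, risingCoeff, risingCoeff]
  field_simp

lemma ordinaryHypergeometric_one_eq_tsum (a b x : ℝ) :
    ₂F₁ a b 1 x = ∑' k, risingCoeff a k * risingCoeff b k * x ^ k := by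
  rw [ordinaryHypergeometric_eq_tsum]
  exact tsum_congr fun k ↦ by
    rw [← ordinaryHypergeometricCoefficient_one, smul_eq_mul]

/-! ### Growth of the coefficients -/

lemma prod_range_eq_ascPochhammer_eval (s : ℝ) (n : ℕ) :
    ∏ j ∈ Finset.range n, (s + j) = (ascPochhammer ℝ n).eval s := by
  induction n with
  | zero => simp
  | succ n ih => rw [Finset.prod_range_succ, ih, ascPochhammer_succ_eval]

/-- Euler's product for `Γ` has the `n + 1` factors `s, …, s + n`, hence the coefficient of index `n
+ 1`. -/
lemma risingCoeff_succ_eq_inv_gammaSeq (s : ℝ) {n : ℕ} (hn : n ≠ 0) :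
    risingCoeff s (n + 1) = (Real.GammaSeq s n)⁻¹ * ((n : ℝ) ^ s / (n + 1)) := by
  have hn' : (0 : ℝ) < n := by positivity
  rw [Real.GammaSeq, prod_range_eq_ascPochhammer_eval, risingCoeff, inv_div, Nat.factorial_succ]
  have h1 : (n.factorial : ℝ) ≠ 0 := by positivity
  have h2 : (n : ℝ) ^ s ≠ 0 := by positivity
  push_cast
  field_simp

lemma tendsto_inv_gammaSeq (s : ℝ) :
    Tendsto (fun n ↦ (Real.GammaSeq s n)⁻¹) atTop (𝓝 (Real.Gamma s)⁻¹) := by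
  -- At a pole `s = -m` both conventions agree with `1/Γ = 0`: `Γ` takes the value `0`, and the
  -- product in the denominator of `GammaSeq` vanishes as soon as `n ≥ m`.
  by_cases h : Real.Gamma s = 0
  · obtain ⟨m, rfl⟩ := (Real.Gamma_eq_zero_iff s).1 h
    rw [h, inv_zero]
    refine tendsto_const_nhds.congr' ?_
    filter_upwards [eventually_ge_atTop m] with n hn
    rw [Real.GammaSeq, Finset.prod_eq_zero (i := m) (by simpa [Nat.lt_succ_iff] using hn) (by simp)]
    simp
  · exact (Real.GammaSeq_tendsto_Gamma s).inv₀ h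

/-- The inverse Gamma sequence converges, hence is bounded, also at the poles of `Γ`; this leaves
the growth rate `k ^ (s - 1)`. -/
lemma exists_abs_risingCoeff_le (s : ℝ) :
    ∃ C, ∀ k : ℕ, k ≠ 0 → |risingCoeff s (k + 1)| ≤ C * (k : ℝ) ^ (s - 1) := by
  obtain ⟨C, hC⟩ := (tendsto_inv_gammaSeq s).abs.bddAbove_range
  refine ⟨C, fun k hk ↦ ?_⟩
  have hk' : (0 : ℝ) < k := by positivity
  have h1 : |(Real.GammaSeq s k)⁻¹| ≤ C := hC ⟨k, rfl⟩
  rw [risingCoeff_succ_eq_inv_gammaSeq s hk, abs_mul, abs_of_nonneg (a := _ / _) (by positivity),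
    Real.rpow_sub_one hk'.ne']
  gcongr
  · exact (abs_nonneg _).trans h1
  · linarith

/-- The series defining `₂F₁ a b 1 1` converges absolutely if `a + b < 1`. -/
lemma summable_abs_risingCoeff_mul {a b : ℝ} (h : a + b < 1) :
    Summable fun k ↦ |risingCoeff a k * risingCoeff b k| := by
  obtain ⟨C, hC⟩ := exists_abs_risingCoeff_le a
  obtain ⟨D, hD⟩ := exists_abs_risingCoeff_le b
  -- The growth bound concerns the index `k + 1` with `k ≠ 0`, so two terms are dropped.
  rw [← summable_nat_add_iff 2]
  have hs : Summable fun k : ℕ ↦ C * D * ((k + 1 : ℕ) : ℝ) ^ (a + b - 2) :=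
    ((summable_nat_add_iff 1).2 (Real.summable_nat_rpow.2 (by linarith))).mul_left _
  refine hs.of_nonneg_of_le (fun _ ↦ abs_nonneg _) fun k ↦ ?_
  have hk : (0 : ℝ) < (k + 1 : ℕ) := by positivity
  have h1 := hC (k + 1) (by simp)
  have h2 := hD (k + 1) (by simp)
  rw [abs_mul]
  calc _ ≤ (C * ((k + 1 : ℕ) : ℝ) ^ (a - 1)) * (D * ((k + 1 : ℕ) : ℝ) ^ (b - 1)) :=
        mul_le_mul h1 h2 (abs_nonneg _) ((abs_nonneg _).trans h1)
    _ = _ := by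
        rw [show a + b - 2 = (a - 1) + (b - 1) by ring, Real.rpow_add hk]; ring

lemma summable_abs_risingCoeff_mul_pow (a b : ℝ) {x : ℝ} (hx : |x| < 1) :
    Summable fun k ↦ |risingCoeff a k * risingCoeff b k * x ^ k| := by
  obtain ⟨C, hC⟩ := exists_abs_risingCoeff_le a
  obtain ⟨D, hD⟩ := exists_abs_risingCoeff_le b
  obtain ⟨m, hm⟩ := exists_nat_ge (a + b - 2)
  rw [← summable_nat_add_iff 2]
  have hs : Summable fun k : ℕ ↦ C * D * |x| * (((k + 1 : ℕ) : ℝ) ^ m * |x| ^ (k + 1)) :=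
    ((summable_nat_add_iff 1).2
      (summable_pow_mul_geometric_of_norm_lt_one m (r := |x|) (by simpa using hx))).mul_left _
  refine hs.of_nonneg_of_le (fun _ ↦ abs_nonneg _) fun k ↦ ?_
  have hk : (0 : ℝ) < (k + 1 : ℕ) := by positivity
  have hk1 : (1 : ℝ) ≤ (k + 1 : ℕ) := by simp
  have h1 := hC (k + 1) (by simp)
  have h2 := hD (k + 1) (by simp)
  have hC0 : 0 ≤ C := nonneg_of_mul_nonneg_left ((abs_nonneg _).trans h1) (by positivity)
  have hD0 : 0 ≤ D := nonneg_of_mul_nonneg_left ((abs_nonneg _).trans h2) (by positivity)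
  rw [abs_mul, abs_mul, abs_pow]
  calc _ ≤ (C * ((k + 1 : ℕ) : ℝ) ^ (a - 1)) * (D * ((k + 1 : ℕ) : ℝ) ^ (b - 1)) * |x| ^ (k + 2) :=
        mul_le_mul_of_nonneg_right
          (mul_le_mul h1 h2 (abs_nonneg _) ((abs_nonneg _).trans h1)) (by positivity)
    _ = C * D * |x| * (((k + 1 : ℕ) : ℝ) ^ (a + b - 2) * |x| ^ (k + 1)) := by
        rw [show a + b - 2 = (a - 1) + (b - 1) by ring, Real.rpow_add hk]; ring
    _ ≤ _ := by
        rw [← Real.rpow_natCast _ m]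
        gcongr

/-! ### Binomial series and Euler's transformation -/

lemma hasSum_risingCoeff_mul_pow (s : ℝ) {x : ℝ} (hx : |x| < 1) :
    HasSum (fun k ↦ risingCoeff s k * x ^ k) ((1 - x) ^ (-s)) := by
  have h := (Real.one_div_one_sub_rpow_hasFPowerSeriesOnBall_zero s).hasSum (y := x)
    (by simpa [Metric.mem_eball, edist_dist] using hx)
  have hx' : 0 ≤ 1 - x := by linarith [(abs_lt.1 hx).2]
  rw [zero_add, one_div, ← Real.rpow_neg hx'] at h
  rw [show (fun k ↦ risingCoeff s k * x ^ k) = _ from funext fun k ↦ ?_]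
  · exact h
  rw [FormalMultilinearSeries.ofScalars_apply_eq, smul_eq_mul, ← Ring.multichoose_eq]
  congr 1
  have h1 := Ring.factorial_nsmul_multichoose_eq_ascPochhammer s k
  rw [Polynomial.ascPochhammer_smeval_eq_eval, nsmul_eq_mul] at h1
  rw [risingCoeff, ← h1, mul_div_cancel_left₀ _ (by positivity)]

/-- The formal power series `(1 - X) ^ (-s)`. -/
noncomputable def binomPowerSeries (s : ℝ) : ℝ⟦X⟧ := PowerSeries.mk (risingCoeff s)

/-- The formal power series of `₂F₁ a b 1`. -/
noncomputable def hypergeometricPowerSeries (a b : ℝ) : ℝ⟦X⟧ :=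
  PowerSeries.mk fun k ↦ risingCoeff a k * risingCoeff b k

lemma binomPowerSeries_ode (s : ℝ) :
    (1 - X) * d⁄dX ℝ (binomPowerSeries s) = C s * binomPowerSeries s := by
  ext n
  rw [sub_mul, one_mul, map_sub, coeff_C_mul]
  cases n with
  | zero => simp [coeff_derivative, binomPowerSeries, risingCoeff_succ]
  | succ n =>
    rw [coeff_succ_X_mul]
    simp only [coeff_derivative, binomPowerSeries, coeff_mk]
    rw [risingCoeff_succ s (n + 1)]
    push_cast
    field_simp
    ring

/-- The hypergeometric differential operator with `c = 1`. -/
noncomputable def hypergeometricOp (a b : ℝ) (f : ℝ⟦X⟧) : ℝ⟦X⟧ :=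
  X * (1 - X) * d⁄dX ℝ (d⁄dX ℝ f) + (1 - C (a + b + 1) * X) * d⁄dX ℝ f - C (a * b) * f

/-- The differential equation is a two-term recurrence. Since `n + 1` never vanishes, the constant
coefficient determines a power series solution. -/
lemma coeff_hypergeometricOp (a b : ℝ) (f : ℝ⟦X⟧) (n : ℕ) :
    coeff n (hypergeometricOp a b f) =
      (n + 1) ^ 2 * coeff (n + 1) f - (a + n) * (b + n) * coeff n f := by
  have h : hypergeometricOp a b f = X * d⁄dX ℝ (d⁄dX ℝ f) - X * (X * d⁄dX ℝ (d⁄dX ℝ f))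
      + d⁄dX ℝ f - C (a + b + 1) * (X * d⁄dX ℝ f) - C (a * b) * f := by
    rw [hypergeometricOp]; ring
  rw [h]
  generalize hc : a + b + 1 = c
  generalize hd : a * b = d
  rcases n with _ | _ | n <;>
  · simp only [map_sub, map_add, coeff_C_mul, coeff_succ_X_mul, coeff_zero_X_mul, coeff_derivative]
    rw [← hc, ← hd]
    push_cast
    ring

lemma hypergeometricOp_hypergeometricPowerSeries (a b : ℝ) :
    hypergeometricOp a b (hypergeometricPowerSeries a b) = 0 := by
  ext n
  rw [coeff_hypergeometricOp]
  simp only [hypergeometricPowerSeries, coeff_mk, map_zero, risingCoeff_succ]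
  field_simp
  ring

lemma eq_hypergeometricPowerSeries {a b : ℝ} {f : ℝ⟦X⟧} (h0 : coeff 0 f = 1)
    (h : hypergeometricOp a b f = 0) : f = hypergeometricPowerSeries a b := by
  ext n
  induction n with
  | zero => simpa [hypergeometricPowerSeries] using h0
  | succ n ih =>
    have h1 := coeff_hypergeometricOp a b f n
    have h2 := coeff_hypergeometricOp a b (hypergeometricPowerSeries a b) n
    rw [h, map_zero] at h1
    rw [hypergeometricOp_hypergeometricPowerSeries, map_zero, ← ih, h1] at h2
    have hn : ((n : ℝ) + 1) ^ 2 ≠ 0 := by positivity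
    exact mul_left_cancel₀ hn (by linarith)

lemma one_sub_X_ne_zero : (1 - X : ℝ⟦X⟧) ≠ 0 := by
  intro h
  simpa using congrArg (coeff 0) h

/-- Euler's transformation, for formal power series. -/
lemma binomPowerSeries_mul_hypergeometricPowerSeries (a b : ℝ) :
    binomPowerSeries (-(1 + a + b)) * hypergeometricPowerSeries (1 + a) (1 + b) =
      hypergeometricPowerSeries (-a) (-b) := by
  apply eq_hypergeometricPowerSeries
  · simp [binomPowerSeries, hypergeometricPowerSeries]
  · set P := binomPowerSeries (-(1 + a + b)) with hP
    set Q := hypergeometricPowerSeries (1 + a) (1 + b) with hQ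
    have hQode := hypergeometricOp_hypergeometricPowerSeries (1 + a) (1 + b)
    have hP1 := binomPowerSeries_ode (-(1 + a + b))
    rw [← hP] at hP1
    rw [← hQ] at hQode
    have hP2 := congrArg (d⁄dX ℝ) hP1
    have hX : d⁄dX ℝ (X : ℝ⟦X⟧) = 1 := derivative_X
    have hC : ∀ r : ℝ, d⁄dX ℝ (C r) = 0 := fun _ ↦ derivative_C
    simp only [Derivation.leibniz, map_sub, Derivation.map_one_eq_zero, hX, hC, smul_eq_mul]
      at hP2
    rw [hypergeometricOp] at hQode ⊢
    simp only [Derivation.leibniz, smul_eq_mul, map_add]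
    simp only [map_add, map_mul, map_neg, map_one] at *
    generalize d⁄dX ℝ (d⁄dX ℝ P) = P2 at *
    generalize d⁄dX ℝ P = P1 at *
    generalize d⁄dX ℝ (d⁄dX ℝ Q) = Q2 at *
    generalize d⁄dX ℝ Q = Q1 at *
    -- The equation for `P` only controls `(1 - X) P'`. Replacing `(1 - X) P''` leaves multiples of
    -- `P' Q` without that factor, so it is supplied here.
    apply mul_left_cancel₀ one_sub_X_ne_zero
    linear_combination X * Q * (1 - X) * hP2 + X * Q * (1 - (1 + C a + C b)) * hP1
      + 2 * X * (1 - X) * Q1 * hP1 + (1 - (2 - (1 + C a + C b)) * X) * Q * hP1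
      + P * (1 - X) * hQode

/-- Euler's transformation of `₂F₁` with third parameter `1`. -/
lemma one_sub_rpow_mul_tsum_risingCoeff (a b : ℝ) {x : ℝ} (hx : |x| < 1) :
    (1 - x) ^ (1 + a + b) * ∑' k, risingCoeff (1 + a) k * risingCoeff (1 + b) k * x ^ k =
      ∑' k, risingCoeff (-a) k * risingCoeff (-b) k * x ^ k := by
  have h := hasSum_risingCoeff_mul_pow (-(1 + a + b)) hx
  rw [neg_neg] at h
  have hs : Summable fun k ↦ ‖risingCoeff (-(1 + a + b)) k * x ^ k‖ := by
    simpa [risingCoeff_one] using summable_abs_risingCoeff_mul_pow (-(1 + a + b)) 1 hx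
  rw [← h.tsum_eq, tsum_mul_tsum_eq_tsum_sum_antidiagonal_of_summable_norm hs
    (summable_abs_risingCoeff_mul_pow (1 + a) (1 + b) hx)]
  refine tsum_congr fun n ↦ ?_
  have hn := congrArg (coeff n) (binomPowerSeries_mul_hypergeometricPowerSeries a b)
  simp only [coeff_mul, binomPowerSeries, hypergeometricPowerSeries, coeff_mk] at hn
  rw [← hn, Finset.sum_mul]
  refine Finset.sum_congr rfl fun p hp ↦ ?_
  rw [← Finset.HasAntidiagonal.mem_antidiagonal.1 hp, pow_add]
  ring

/-! ### Gauss's summation theorem -/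

/-- If `u k / v k` tends to `l` and `∑ v k * x ^ k` diverges as `x` tends to `1` from the left,
then the quotient of the two power series tends to `l`. -/
lemma tendsto_tsum_div_tsum_of_tendsto_div {u v : ℕ → ℝ} {l : ℝ} (hv : ∀ k, 0 < v k)
    (huv : Tendsto (fun k ↦ u k / v k) atTop (𝓝 l))
    (hvs : ∀ x, |x| < 1 → Summable fun k ↦ v k * x ^ k)
    (hus : ∀ x, |x| < 1 → Summable fun k ↦ u k * x ^ k)
    (hdiv : Tendsto (fun x : ℝ ↦ ∑' k, v k * x ^ k) (𝓝[<] 1) atTop) :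
    Tendsto (fun x : ℝ ↦ (∑' k, u k * x ^ k) / ∑' k, v k * x ^ k) (𝓝[<] 1) (𝓝 l) := by
  rw [Metric.tendsto_nhds]
  intro ε hε
  obtain ⟨N, hN⟩ := eventually_atTop.1 (Metric.tendsto_nhds.1 huv (ε / 2) (by positivity))
  have hle : ∀ k ≥ N, |u k - l * v k| ≤ ε / 2 * v k := fun k hk ↦ by
    have h1 := (hN k hk).le
    rw [Real.dist_eq] at h1
    calc |u k - l * v k| = |u k / v k - l| * v k := by
          rw [← abs_of_pos (hv k), ← abs_mul, abs_of_pos (hv k), sub_mul,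
            div_mul_cancel₀ _ (hv k).ne']
      _ ≤ _ := mul_le_mul_of_nonneg_right h1 (hv k).le
  -- `B` bounds the first `N` terms uniformly in `x ∈ (0, 1)`. Since the denominator diverges, it
  -- eventually absorbs `B` into the remaining `ε / 2`.
  set B := ∑ k ∈ Finset.range N, |u k - l * v k|
  have hmem : ∀ᶠ x : ℝ in 𝓝[<] 1, x ∈ Set.Ioo 0 1 := Ioo_mem_nhdsLT zero_lt_one
  filter_upwards [hmem, hdiv.eventually_gt_atTop (2 * B / ε), hdiv.eventually_gt_atTop 0]
    with x hx hxB hx0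
  have hx1 : |x| < 1 := by rw [abs_of_pos hx.1]; exact hx.2
  have hsv := hvs x hx1
  have hsu := hus x hx1
  have hsd : Summable fun k ↦ (u k - l * v k) * x ^ k := by
    simpa [sub_mul, mul_assoc] using hsu.sub (hsv.mul_left l)
  have heq : ∑' k, u k * x ^ k - l * ∑' k, v k * x ^ k = ∑' k, (u k - l * v k) * x ^ k := by
    rw [← tsum_mul_left, ← hsu.tsum_sub (hsv.mul_left l)]
    exact tsum_congr fun k ↦ by ring
  have hterm : ∀ k, |(u k - l * v k) * x ^ k| ≤
      (if k ∈ Finset.range N then |u k - l * v k| else 0) + ε / 2 * (v k * x ^ k) := fun k ↦ by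
    have hxk : 0 < x ^ k := pow_pos hx.1 k
    rw [abs_mul, abs_of_pos hxk]
    have hvk := hv k
    split_ifs with hk
    · have : |u k - l * v k| * x ^ k ≤ |u k - l * v k| * 1 :=
        mul_le_mul_of_nonneg_left (pow_le_one₀ hx.1.le hx.2.le) (abs_nonneg _)
      have : 0 < ε / 2 * (v k * x ^ k) := by positivity
      linarith
    · have := mul_le_mul_of_nonneg_right (hle k (by simpa using hk)) hxk.le
      linarith
  have hsB : HasSum (fun k ↦ if k ∈ Finset.range N then |u k - l * v k| else 0) B := by
    rw [show B = _ from (Finset.sum_congr rfl fun k hk ↦ (if_pos hk).symm)]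
    exact hasSum_sum_of_ne_finset_zero fun k hk ↦ if_neg hk
  have hbound : |∑' k, u k * x ^ k - l * ∑' k, v k * x ^ k| ≤ B + ε / 2 * ∑' k, v k * x ^ k := by
    rw [heq]
    exact tsum_of_norm_bounded (f := fun k ↦ (u k - l * v k) * x ^ k)
      (hsB.add (hsv.hasSum.mul_left (ε / 2))) hterm
  rw [Real.dist_eq, show (∑' k, u k * x ^ k) / (∑' k, v k * x ^ k) - l =
    (∑' k, u k * x ^ k - l * ∑' k, v k * x ^ k) / (∑' k, v k * x ^ k) by field_simp,
    abs_div, abs_of_pos hx0, div_lt_iff₀ hx0]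
  rw [div_lt_iff₀ hε] at hxB
  linarith

/-- In terms of Gamma sequences the powers of `n` combine to `n / (n + 1)`, which tends to `1`. -/
lemma tendsto_risingCoeff_mul_div {a b : ℝ} (hab : -1 < a + b) :
    Tendsto (fun k ↦ risingCoeff (1 + a) k * risingCoeff (1 + b) k / risingCoeff (1 + a + b) k)
      atTop (𝓝 (Real.Gamma (1 + a + b) / (Real.Gamma (1 + a) * Real.Gamma (1 + b)))) := by
  rw [← tendsto_add_atTop_iff_nat 1]
  have hΓ : Real.Gamma (1 + a + b) ≠ 0 := (Real.Gamma_pos_of_pos (by linarith)).ne'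
  have h := ((tendsto_inv_gammaSeq (1 + a)).mul (tendsto_inv_gammaSeq (1 + b))).div
    (tendsto_inv_gammaSeq (1 + a + b)) (inv_ne_zero hΓ)
  have h1 := h.mul (tendsto_natCast_div_add_atTop (1 : ℝ))
  rw [mul_one, div_inv_eq_mul] at h1
  convert h1.congr' ?_ using 2
  · field_simp
  · filter_upwards [eventually_ne_atTop 0] with n hn
    have hn' : (0 : ℝ) < n := by positivity
    have e : (n : ℝ) ^ (1 + a) * (n : ℝ) ^ (1 + b) = (n : ℝ) ^ (1 + a + b) * n := by
      rw [← Real.rpow_add hn', ← Real.rpow_add_one hn'.ne']; ring_nf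
    have e' : (n : ℝ) ^ (1 + a + b) ≠ 0 := by positivity
    simp only [risingCoeff_succ_eq_inv_gammaSeq _ hn, Pi.div_apply]
    have e2 : (n : ℝ) / (n + 1) =
        (n : ℝ) ^ (1 + a) * (n : ℝ) ^ (1 + b) / (n : ℝ) ^ (1 + a + b) / (n + 1) := by
      rw [e, mul_div_cancel_left₀ _ e']
    rw [e2]
    field_simp

/-- Gauss's summation theorem with third parameter `1`. -/
lemma tsum_risingCoeff_mul_eq_gamma {a b : ℝ} (hab : -1 < a + b) :
    ∑' k, risingCoeff (-a) k * risingCoeff (-b) k =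
      Real.Gamma (1 + a + b) / (Real.Gamma (1 + a) * Real.Gamma (1 + b)) := by
  have hmem : ∀ᶠ x : ℝ in 𝓝[<] 1, x ∈ Set.Ioo 0 1 := Ioo_mem_nhdsLT zero_lt_one
  have habs : ∀ x : ℝ, x ∈ Set.Ioo 0 1 → |x| < 1 := fun x hx ↦ by
    rw [abs_of_pos hx.1]; exact hx.2
  have hsum := summable_abs_risingCoeff_mul (a := -a) (b := -b) (by linarith)
  have h1 : Tendsto (fun x : ℝ ↦ ∑' k, risingCoeff (-a) k * risingCoeff (-b) k * x ^ k)
      (𝓝[<] 1) (𝓝 (∑' k, risingCoeff (-a) k * risingCoeff (-b) k)) := by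
    refine tendsto_tsum_of_dominated_convergence hsum (fun k ↦ ?_) ?_
    · have : Continuous fun x : ℝ ↦ risingCoeff (-a) k * risingCoeff (-b) k * x ^ k := by fun_prop
      simpa using (this.tendsto 1).mono_left nhdsWithin_le_nhds
    · filter_upwards [hmem] with x hx k
      rw [norm_mul, Real.norm_eq_abs, Real.norm_eq_abs, abs_pow]
      exact mul_le_of_le_one_right (abs_nonneg _) (pow_le_one₀ (abs_nonneg _) (habs x hx).le)
  have hbin : ∀ x : ℝ, x ∈ Set.Ioo 0 1 → ∑' k, risingCoeff (1 + a + b) k * x ^ k =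
      ((1 - x) ^ (1 + a + b))⁻¹ := fun x hx ↦ by
    rw [(hasSum_risingCoeff_mul_pow _ (habs x hx)).tsum_eq, Real.rpow_neg (by linarith [hx.2])]
  have hdiv : Tendsto (fun x : ℝ ↦ ∑' k, risingCoeff (1 + a + b) k * x ^ k) (𝓝[<] 1) atTop := by
    have h0 : Tendsto (fun x : ℝ ↦ (1 - x) ^ (1 + a + b)) (𝓝[<] 1) (𝓝[>] 0) := by
      refine tendsto_nhdsWithin_iff.2 ⟨?_, ?_⟩
      · have : Tendsto (fun x : ℝ ↦ 1 - x) (𝓝[<] 1) (𝓝 0) := by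
          have h : Continuous fun x : ℝ ↦ 1 - x := by fun_prop
          simpa using (h.tendsto 1).mono_left nhdsWithin_le_nhds
        have h := this.rpow_const (p := 1 + a + b) (Or.inr (by linarith))
        rwa [Real.zero_rpow (by linarith)] at h
      · filter_upwards [hmem] with x hx
        exact Real.rpow_pos_of_pos (by linarith [hx.2]) _
    refine (tendsto_inv_nhdsGT_zero.comp h0).congr' ?_
    filter_upwards [hmem] with x hx
    rw [hbin x hx, Function.comp_apply]
  -- By the binomial series, dividing by the comparison series multiplies by `(1 - x) ^ (1 + a +
  -- b)`: the quotient is the left side of Euler's transformation.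
  have h2 := tendsto_tsum_div_tsum_of_tendsto_div
    (fun k ↦ risingCoeff_pos (s := 1 + a + b) (by linarith) k)
    (tendsto_risingCoeff_mul_div hab)
    (fun x hx ↦ (hasSum_risingCoeff_mul_pow _ hx).summable)
    (fun x hx ↦ (summable_abs_risingCoeff_mul_pow _ _ hx).of_abs) hdiv
  refine tendsto_nhds_unique h1 (h2.congr' ?_)
  filter_upwards [hmem] with x hx
  rw [hbin x hx, div_inv_eq_mul, mul_comm, one_sub_rpow_mul_tsum_risingCoeff a b (habs x hx)]

end WeibullField

namespace WeibullField

/-! ### Angular integrals -/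

open Real in
lemma integral_cos_pow_two_mul (k : ℕ) :
    ∫ θ in -π..π, cos θ ^ (2 * k) =
      2 * π * ((2 * k).factorial / (4 ^ k * (k.factorial : ℝ) ^ 2)) := by
  induction k with
  | zero => simp; ring
  | succ k ih =>
    rw [mul_add_one, integral_cos_pow, ih, Nat.factorial_succ, Nat.factorial_succ,
      Nat.factorial_succ k]
    have : (k.factorial : ℝ) ≠ 0 := by positivity
    push_cast
    simp only [sin_neg, sin_pi]
    field_simp
    ring

open Real in
lemma integral_cos_pow_two_mul_add_one (k : ℕ) :
    ∫ θ in -π..π, cos θ ^ (2 * k + 1) = 0 := by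
  induction k with
  | zero => simp
  | succ k ih =>
    rw [mul_add_one, add_right_comm, integral_cos_pow, ih]
    simp

open Real in
-- This is the series of `2π I₀(x)`, with `I₀` the modified Bessel function: odd powers of the
-- cosine integrate to zero.
lemma hasSum_integral_exp_mul_cos (x : ℝ) :
    HasSum (fun k : ℕ ↦ 2 * π * ((x ^ 2 / 4) ^ k / (k.factorial : ℝ) ^ 2))
      (∫ θ in -π..π, exp (x * cos θ)) := by
  have h : HasSum (fun n : ℕ ↦ ∫ θ in -π..π, (x * cos θ) ^ n / n.factorial)
      (∫ θ in -π..π, exp (x * cos θ)) := by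
    refine intervalIntegral.hasSum_integral_of_dominated_convergence
      (fun n _ ↦ |x| ^ n / n.factorial) (fun n ↦ ?_) (fun n ↦ ?_) ?_ ?_ ?_
    · exact Continuous.aestronglyMeasurable (by fun_prop)
    · filter_upwards with θ _
      rw [norm_div, norm_pow, norm_mul, Real.norm_eq_abs, Real.norm_eq_abs, Real.norm_natCast]
      gcongr
      exact mul_le_of_le_one_right (abs_nonneg _) (abs_cos_le_one θ)
    · filter_upwards with θ _ using Real.summable_pow_div_factorial _
    · simp
    · filter_upwards with θ _
      rw [Real.exp_eq_exp_ℝ]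
      exact NormedSpace.expSeries_div_hasSum_exp _
  have h' : ∀ n : ℕ, ∫ θ in -π..π, (x * cos θ) ^ n / n.factorial =
      x ^ n / n.factorial * ∫ θ in -π..π, cos θ ^ n := fun n ↦ by
    rw [← intervalIntegral.integral_const_mul]
    congr 1 with θ
    rw [mul_pow]; ring
  have heven : ∀ k : ℕ, ∫ θ in -π..π, (x * cos θ) ^ (2 * k) / (2 * k).factorial =
      2 * π * ((x ^ 2 / 4) ^ k / (k.factorial : ℝ) ^ 2) := fun k ↦ by
    rw [h', integral_cos_pow_two_mul, div_pow, ← pow_mul]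
    have : ((2 * k).factorial : ℝ) ≠ 0 := by positivity
    field_simp
  have hodd : ∀ k : ℕ, ∫ θ in -π..π, (x * cos θ) ^ (2 * k + 1) / (2 * k + 1).factorial = 0 :=
    fun k ↦ by rw [h', integral_cos_pow_two_mul_add_one, mul_zero]
  have hs : Summable fun k : ℕ ↦ ∫ θ in -π..π, (x * cos θ) ^ (2 * k) / (2 * k).factorial :=
    h.summable.comp_injective (i := fun k ↦ 2 * k) fun _ _ hab ↦ by simpa using hab
  have h2 := HasSum.even_add_odd (f := fun n : ℕ ↦ ∫ θ in -π..π, (x * cos θ) ^ n / n.factorial)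
    hs.hasSum (m' := 0) (by simp only [hodd]; exact hasSum_zero)
  rw [h.unique h2, add_zero]
  simpa only [heven] using hs.hasSum

open Real in
-- With `p + iq` in polar form, the exponent is a cosine of a shifted angle, and the shift is
-- harmless over a full period.
lemma hasSum_integral_exp_cos_sin (p q : ℝ) :
    HasSum (fun k : ℕ ↦ 2 * π * (((p ^ 2 + q ^ 2) / 4) ^ k / (k.factorial : ℝ) ^ 2))
      (∫ θ in -π..π, exp (p * cos θ + q * sin θ)) := by
  set z : ℂ := ⟨p, q⟩
  have hp : ‖z‖ * cos z.arg = p := Complex.norm_mul_cos_arg z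
  have hq : ‖z‖ * sin z.arg = q := Complex.norm_mul_sin_arg z
  have hn : ‖z‖ ^ 2 = p ^ 2 + q ^ 2 := by rw [Complex.sq_norm, Complex.normSq_mk]; ring
  have hper : Function.Periodic (fun θ ↦ exp (‖z‖ * cos θ)) (2 * π) := fun θ ↦ by
    simp [cos_add_two_pi]
  have h : ∫ θ in -π..π, exp (p * cos θ + q * sin θ) = ∫ θ in -π..π, exp (‖z‖ * cos θ) := by
    have h1 : ∀ θ, p * cos θ + q * sin θ = ‖z‖ * cos (θ - z.arg) := fun θ ↦ by
      rw [cos_sub, ← hp, ← hq]; ring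
    simp only [h1]
    rw [intervalIntegral.integral_comp_sub_right (fun θ ↦ exp (‖z‖ * cos θ))]
    have := hper.intervalIntegral_add_eq (-π - z.arg) (-π)
    rwa [show -π - z.arg + 2 * π = π - z.arg by ring, show -π + 2 * π = π by ring] at this
  rw [h, ← hn]
  exact hasSum_integral_exp_mul_cos ‖z‖

open Real in
lemma lintegral_exp_cos_sin (p q : ℝ) :
    ∫⁻ θ in Set.Ioo (-π) π, ENNReal.ofReal (exp (p * cos θ + q * sin θ)) =
      ∑' k : ℕ, ENNReal.ofReal (2 * π * (((p ^ 2 + q ^ 2) / 4) ^ k / (k.factorial : ℝ) ^ 2)) := by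
  have hs := hasSum_integral_exp_cos_sin p q
  rw [← ENNReal.ofReal_tsum_of_nonneg (fun k ↦ by positivity) hs.summable, hs.tsum_eq,
    intervalIntegral.integral_of_le (by linarith [pi_pos]), restrict_Ioo_eq_restrict_Ioc,
    ofReal_integral_eq_lintegral_ofReal]
  · exact (Continuous.integrableOn_Icc (by fun_prop)).mono_set Set.Ioc_subset_Icc_self
  · exact Filter.Eventually.of_forall fun θ ↦ (exp_pos _).le

/-! ### The law of half the squared norm of a planar Gaussian vector -/

/-- The substitution `y = t² / 2` absorbs the Jacobian `t` of polar coordinates. -/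
lemma lintegral_Ioi_half_sq (g : ℝ → ENNReal) :
    ∫⁻ t in Set.Ioi (0 : ℝ), ENNReal.ofReal t * g (t ^ 2 / 2) = ∫⁻ y in Set.Ioi (0 : ℝ), g y := by
  have himg : (fun t : ℝ ↦ t ^ 2 / 2) '' Set.Ioi 0 = Set.Ioi 0 := by
    ext y
    simp only [Set.mem_image, Set.mem_Ioi]
    refine ⟨fun ⟨t, ht, h⟩ ↦ h ▸ by positivity, fun hy ↦ ⟨√(2 * y), by positivity, ?_⟩⟩
    rw [Real.sq_sqrt (by positivity)]; ring
  have h := lintegral_image_eq_lintegral_abs_deriv_mul (s := Set.Ioi (0 : ℝ))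
    (f := fun t ↦ t ^ 2 / 2) (f' := fun t ↦ t) measurableSet_Ioi
    (fun t _ ↦ by
      have := ((hasDerivAt_pow 2 t).div_const 2).hasDerivWithinAt (s := Set.Ioi 0)
      simpa using this)
    (fun a ha b hb hab ↦ by
      simp only [Set.mem_Ioi] at ha hb
      have : a ^ 2 = b ^ 2 := by simp only at hab; linarith
      exact (pow_left_inj₀ ha.le hb.le two_ne_zero).1 this) g
  rw [himg] at h
  rw [h]
  exact setLIntegral_congr_fun measurableSet_Ioi fun t ht ↦ by
    simp only [abs_of_pos (Set.mem_Ioi.1 ht)]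

open Real in
lemma gaussianPDFReal_mul_gaussianPDFReal_polar (m₁ m₂ : ℝ) {v : NNReal} (hv : v ≠ 0) (t θ : ℝ) :
    gaussianPDFReal m₁ v (t * cos θ) * gaussianPDFReal m₂ v (t * sin θ) =
      (2 * π * v)⁻¹ * exp (-(t ^ 2 / 2 + (m₁ ^ 2 + m₂ ^ 2) / 2) / v) *
        exp (t * m₁ / v * cos θ + t * m₂ / v * sin θ) := by
  have hv' : (v : ℝ) ≠ 0 := by exact_mod_cast hv
  rw [gaussianPDFReal, gaussianPDFReal, mul_mul_mul_comm, ← mul_inv, ← exp_add, mul_assoc _ (exp _),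
    ← exp_add, Real.mul_self_sqrt (by positivity)]
  congr 2
  field_simp
  linear_combination (- t ^ 2) * sin_sq_add_cos_sq θ

open Real in
lemma lintegral_half_norm_sq_gaussianReal_prod (m₁ m₂ : ℝ) {v : NNReal} (hv : v ≠ 0)
    {g : ℝ → ENNReal} (hg : Measurable g) :
    ∫⁻ p, g ((p.1 ^ 2 + p.2 ^ 2) / 2) ∂((gaussianReal m₁ v).prod (gaussianReal m₂ v)) =
      ∑' k : ℕ, ∫⁻ y in Set.Ioi 0, g y * ENNReal.ofReal
        ((v : ℝ)⁻¹ * exp (-(y + (m₁ ^ 2 + m₂ ^ 2) / 2) / v) *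
          (((m₁ ^ 2 + m₂ ^ 2) / 2 * y / v ^ 2) ^ k / (k.factorial : ℝ) ^ 2)) := by
  have hv' : (0 : ℝ) < v := by positivity
  set l := (m₁ ^ 2 + m₂ ^ 2) / 2 with hl
  rw [gaussianReal_of_var_ne_zero _ hv, gaussianReal_of_var_ne_zero _ hv,
    prod_withDensity (measurable_gaussianPDF _ _) (measurable_gaussianPDF _ _),
    lintegral_withDensity_eq_lintegral_mul _ (by fun_prop) (by fun_prop),
    ← Measure.volume_eq_prod, ← lintegral_comp_polarCoord_symm, polarCoord_target,
    Measure.volume_eq_prod, setLIntegral_prod _ (by fun_prop)]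
  have hinner : ∀ t ∈ Set.Ioi (0 : ℝ), ∫⁻ θ in Set.Ioo (-π) π, ENNReal.ofReal (t, θ).1 •
        ((fun z : ℝ × ℝ ↦ gaussianPDF m₁ v z.1 * gaussianPDF m₂ v z.2) *
          fun p : ℝ × ℝ ↦ g ((p.1 ^ 2 + p.2 ^ 2) / 2)) (polarCoord.symm (t, θ)) =
      ENNReal.ofReal t * ∑' k : ℕ, g (t ^ 2 / 2) * ENNReal.ofReal
        ((v : ℝ)⁻¹ * exp (-(t ^ 2 / 2 + l) / v) *
          ((l * (t ^ 2 / 2) / v ^ 2) ^ k / (k.factorial : ℝ) ^ 2)) := fun t ht ↦ by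
    have ht' : 0 < t := ht
    have hpt : ∀ θ, ENNReal.ofReal t •
        ((fun z : ℝ × ℝ ↦ gaussianPDF m₁ v z.1 * gaussianPDF m₂ v z.2) *
          fun p : ℝ × ℝ ↦ g ((p.1 ^ 2 + p.2 ^ 2) / 2)) (polarCoord.symm (t, θ)) =
        (ENNReal.ofReal t * g (t ^ 2 / 2) *
          ENNReal.ofReal ((2 * π * v)⁻¹ * exp (-(t ^ 2 / 2 + l) / v))) *
          ENNReal.ofReal (exp (t * m₁ / v * cos θ + t * m₂ / v * sin θ)) := fun θ ↦ by
      simp only [polarCoord_symm_apply, Pi.mul_apply, smul_eq_mul, gaussianPDF]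
      rw [← ENNReal.ofReal_mul (gaussianPDFReal_nonneg _ _ _),
        gaussianPDFReal_mul_gaussianPDFReal_polar _ _ hv, ENNReal.ofReal_mul (by positivity),
        show ((t * cos θ) ^ 2 + (t * sin θ) ^ 2) / 2 = t ^ 2 / 2 by
          linear_combination t ^ 2 / 2 * sin_sq_add_cos_sq θ]
      ring
    simp only [hpt]
    rw [lintegral_const_mul _ (by fun_prop), lintegral_exp_cos_sin, mul_assoc, mul_assoc,
      ← ENNReal.tsum_mul_left, ← ENNReal.tsum_mul_left]
    congr 2 with k
    rw [← ENNReal.ofReal_mul (by positivity)]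
    congr 2
    have : ((t * m₁ / v) ^ 2 + (t * m₂ / v) ^ 2) / 4 = l * (t ^ 2 / 2) / v ^ 2 := by
      rw [hl]; field_simp; ring
    rw [this]
    field_simp
  rw [setLIntegral_congr_fun measurableSet_Ioi hinner,
    lintegral_Ioi_half_sq (fun y ↦ ∑' k : ℕ, g y * ENNReal.ofReal
        ((v : ℝ)⁻¹ * exp (-(y + l) / v) * ((l * y / v ^ 2) ^ k / (k.factorial : ℝ) ^ 2))),
    lintegral_tsum fun k ↦ by fun_prop]

open Real in
/-- Half the squared norm of a standard planar Gaussian vector is exponentially distributed. -/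
lemma lintegral_half_norm_sq_gaussianReal_prod_standard {g : ℝ → ENNReal} (hg : Measurable g) :
    ∫⁻ p, g ((p.1 ^ 2 + p.2 ^ 2) / 2) ∂((gaussianReal 0 1).prod (gaussianReal 0 1)) =
      ∫⁻ y in Set.Ioi 0, g y * ENNReal.ofReal (exp (-y)) := by
  rw [lintegral_half_norm_sq_gaussianReal_prod 0 0 one_ne_zero hg, tsum_eq_single 0]
  · simp
  · intro k hk
    simp [hk]

end WeibullField

namespace WeibullField

/-! ### Mixed moments of correlated exponential variables -/

lemma lintegral_rpow_mul_exp_neg_div {s v : ℝ} (hs : -1 < s) (hv : 0 < v) :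
    ∫⁻ y in Set.Ioi 0, ENNReal.ofReal (y ^ s * Real.exp (-y / v)) =
      ENNReal.ofReal (v ^ (s + 1) * Real.Gamma (s + 1)) := by
  have h := Real.integral_rpow_mul_exp_neg_mul_Ioi (a := s + 1) (r := v⁻¹) (by linarith)
    (by positivity)
  have hint := integrableOn_rpow_mul_exp_neg_mul_rpow (p := 1) (b := v⁻¹) hs one_pos
    (by positivity)
  simp only [add_sub_cancel_right, one_div, inv_inv, ← div_eq_inv_mul, Real.rpow_one,
    ← neg_div, neg_mul] at h hint
  rw [← h, ofReal_integral_eq_lintegral_ofReal hint]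
  exact (ae_restrict_iff' measurableSet_Ioi).2 (.of_forall fun y hy ↦ by
    have : (0 : ℝ) < y := hy
    positivity)

lemma gamma_add_natCast {s : ℝ} (hs : 0 < s) (k : ℕ) :
    Real.Gamma (s + k) = Real.Gamma s * (k.factorial * risingCoeff s k) := by
  induction k with
  | zero => simp
  | succ k ih =>
    rw [Nat.cast_succ, ← add_assoc, Real.Gamma_add_one (by positivity), ih, risingCoeff_succ,
      Nat.factorial_succ]
    push_cast
    field_simp

/-- The constant `c` stands for `x ^ a`, fixed while the second norm is integrated; `l` will be `ρ²
x`. -/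
lemma lintegral_noncentral_moment {b v c l : ℝ} (hb : -1 < b) (hv : 0 < v) (hl : 0 ≤ l)
    (hc : 0 ≤ c) (k : ℕ) :
    ∫⁻ y in Set.Ioi 0, ENNReal.ofReal (c * y ^ b) * ENNReal.ofReal
        (v⁻¹ * Real.exp (-(y + l) / v) * ((l * y / v ^ 2) ^ k / (k.factorial : ℝ) ^ 2)) =
      ENNReal.ofReal (c * v⁻¹ * Real.exp (-l / v) * (l / v ^ 2) ^ k / (k.factorial : ℝ) ^ 2 *
        (v ^ (b + k + 1) * Real.Gamma (b + k + 1))) := by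
  have hk : (0 : ℝ) ≤ k := by positivity
  rw [ENNReal.ofReal_mul (p := _ / _) (by positivity),
    ← lintegral_rpow_mul_exp_neg_div (s := b + k) (by linarith) hv,
    ← lintegral_const_mul _ (by fun_prop)]
  refine setLIntegral_congr_fun measurableSet_Ioi fun y hy ↦ ?_
  have hy' : (0 : ℝ) < y := hy
  rw [← ENNReal.ofReal_mul (by positivity), ← ENNReal.ofReal_mul (by positivity)]
  congr 1
  rw [Real.rpow_add_natCast hy'.ne', neg_add, add_div, Real.exp_add, mul_div_right_comm l y, mul_pow]
  ring

/-- The mixed moment of the halved squared norms of a standard planar Gaussian vector `u` and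
of a planar Gaussian vector with mean `ρ • u` and covariance `1 - ρ ^ 2` times the identity. -/
lemma lintegral_mixed_moment {a b ρ : ℝ} {v : NNReal} (ha : -1 < a) (hb : -1 < b)
    (hv : v ≠ 0) (hρ : (v : ℝ) = 1 - ρ ^ 2) :
    ∫⁻ u, ∫⁻ w, ENNReal.ofReal (((u.1 ^ 2 + u.2 ^ 2) / 2) ^ a * ((w.1 ^ 2 + w.2 ^ 2) / 2) ^ b)
        ∂((gaussianReal (ρ * u.1) v).prod (gaussianReal (ρ * u.2) v))
        ∂((gaussianReal 0 1).prod (gaussianReal 0 1)) =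
      ENNReal.ofReal (Real.Gamma (1 + a) * Real.Gamma (1 + b) *
        ∑' k, risingCoeff (-a) k * risingCoeff (-b) k * (ρ ^ 2) ^ k) := by
  have hv' : (0 : ℝ) < v := by positivity
  have hρ1 : |ρ ^ 2| < 1 := by rw [abs_of_nonneg (sq_nonneg ρ)]; linarith
  have hinner : ∀ u : ℝ × ℝ, ∫⁻ w, ENNReal.ofReal
        (((u.1 ^ 2 + u.2 ^ 2) / 2) ^ a * ((w.1 ^ 2 + w.2 ^ 2) / 2) ^ b)
        ∂((gaussianReal (ρ * u.1) v).prod (gaussianReal (ρ * u.2) v)) =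
      (fun x ↦ ∑' k : ℕ, ENNReal.ofReal (x ^ a * (v : ℝ)⁻¹ * Real.exp (-(ρ ^ 2 * x) / v) *
        (ρ ^ 2 * x / v ^ 2) ^ k / (k.factorial : ℝ) ^ 2 *
        (v ^ (b + k + 1) * Real.Gamma (b + k + 1)))) ((u.1 ^ 2 + u.2 ^ 2) / 2) := fun u ↦ by
    rw [lintegral_half_norm_sq_gaussianReal_prod (ρ * u.1) (ρ * u.2) hv
      (g := fun y ↦ ENNReal.ofReal (((u.1 ^ 2 + u.2 ^ 2) / 2) ^ a * y ^ b)) (by fun_prop),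
      show ((ρ * u.1) ^ 2 + (ρ * u.2) ^ 2) / 2 = ρ ^ 2 * ((u.1 ^ 2 + u.2 ^ 2) / 2) by ring]
    exact tsum_congr fun k ↦ lintegral_noncentral_moment hb hv' (by positivity) (by positivity) k
  rw [lintegral_congr hinner, lintegral_half_norm_sq_gaussianReal_prod_standard
    (g := fun x ↦ ∑' k : ℕ, ENNReal.ofReal (x ^ a * (v : ℝ)⁻¹ * Real.exp (-(ρ ^ 2 * x) / v) *
        (ρ ^ 2 * x / v ^ 2) ^ k / (k.factorial : ℝ) ^ 2 *
        (v ^ (b + k + 1) * Real.Gamma (b + k + 1)))) (.tsum fun k ↦ by fun_prop)]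
  simp only [← ENNReal.tsum_mul_right]
  rw [lintegral_tsum fun k ↦ by fun_prop, ← one_sub_rpow_mul_tsum_risingCoeff a b hρ1,
    ← mul_assoc, ← tsum_mul_left, ENNReal.ofReal_tsum_of_nonneg]
  · refine tsum_congr fun k ↦ ?_
    have hk : (0 : ℝ) ≤ k := by positivity
    have hΓ : 0 ≤ Real.Gamma (b + k + 1) := Real.Gamma_nonneg_of_nonneg (by linarith)
    have h1 : ∀ x ∈ Set.Ioi (0 : ℝ), ENNReal.ofReal (x ^ a * (v : ℝ)⁻¹ *
        Real.exp (-(ρ ^ 2 * x) / v) * (ρ ^ 2 * x / v ^ 2) ^ k / (k.factorial : ℝ) ^ 2 *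
        (v ^ (b + k + 1) * Real.Gamma (b + k + 1))) * ENNReal.ofReal (Real.exp (-x)) =
        ENNReal.ofReal ((v : ℝ)⁻¹ * (ρ ^ 2 / v ^ 2) ^ k / (k.factorial : ℝ) ^ 2 *
        (v ^ (b + k + 1) * Real.Gamma (b + k + 1))) *
        ENNReal.ofReal (x ^ (a + k) * Real.exp (-x / v)) := fun x hx ↦ by
      have hx' : (0 : ℝ) < x := hx
      rw [← ENNReal.ofReal_mul (by positivity), ← ENNReal.ofReal_mul (by positivity)]
      congr 1
      -- Here `ρ² / v + 1 = 1 / v`, because `v = 1 - ρ²`.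
      have : Real.exp (-x / v) = Real.exp (-(ρ ^ 2 * x) / v) * Real.exp (-x) := by
        rw [← Real.exp_add]
        congr 1
        field_simp
        rw [hρ]; ring
      rw [this, Real.rpow_add_natCast hx'.ne', mul_div_right_comm (ρ ^ 2) x, mul_pow]
      ring
    rw [setLIntegral_congr_fun measurableSet_Ioi h1, lintegral_const_mul _ (by fun_prop),
      lintegral_rpow_mul_exp_neg_div (by linarith) hv', ← ENNReal.ofReal_mul (by positivity)]
    -- The remaining factor `v ^ (2k)` from the two Gamma integrals cancels against `(ρ² / v²) ^ k`.
    have e : (v : ℝ) ^ (1 + a + b) = (v : ℝ)⁻¹ * (v : ℝ) ^ (1 + a) * (v : ℝ) ^ (1 + b) := by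
      rw [mul_assoc, ← Real.rpow_add hv', ← Real.rpow_neg_one, ← Real.rpow_add hv']
      ring_nf
    congr 1
    rw [← hρ, show b + k + 1 = 1 + b + k by ring, show a + k + 1 = 1 + a + k by ring,
      gamma_add_natCast (by linarith), gamma_add_natCast (by linarith),
      Real.rpow_add_natCast hv'.ne', Real.rpow_add_natCast hv'.ne', e, div_pow]
    field_simp
    ring
  · intro k
    have h1 := Real.Gamma_pos_of_pos (show 0 < 1 + a by linarith)
    have h2 := Real.Gamma_pos_of_pos (show 0 < 1 + b by linarith)
    have h3 := risingCoeff_pos (show 0 < 1 + a by linarith) k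
    have h4 := risingCoeff_pos (show 0 < 1 + b by linarith) k
    rw [← hρ]
    positivity
  · exact (summable_abs_risingCoeff_mul_pow _ _ hρ1).of_abs.mul_left _

/-! ### The bivariate Gaussian law -/

/-- The law of a standard bivariate Gaussian vector with correlation `ρ`. -/
noncomputable def bivariateGaussian (ρ : ℝ) : Measure (ℝ × ℝ) :=
  ((gaussianReal 0 1).prod (gaussianReal 0 (1 - ρ ^ 2).toNNReal)).map
    fun p ↦ (p.1, ρ * p.1 + p.2)

instance (ρ : ℝ) : IsProbabilityMeasure (bivariateGaussian ρ) :=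
  Measure.isProbabilityMeasure_map (by fun_prop)

section Law

variable {Ω : Type*} [MeasurableSpace Ω] {P : Measure Ω} {X Y : Ω → ℝ}

lemma variance_sub_const_mul [IsProbabilityMeasure P] (hX : MemLp X 2 P) (hY : MemLp Y 2 P)
    (hX1 : variance X P = 1) (hY1 : variance Y P = 1) :
    variance (fun ω ↦ Y ω - cov[X, Y; P] * X ω) P = 1 - cov[X, Y; P] ^ 2 := by
  rw [variance_fun_sub hY (hX.const_mul _), variance_const_mul, covariance_const_mul_right,
    covariance_comm Y X, hX1, hY1]
  ring

lemma covariance_sq_le_one [IsProbabilityMeasure P] (hX : MemLp X 2 P) (hY : MemLp Y 2 P)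
    (hX1 : variance X P = 1) (hY1 : variance Y P = 1) : cov[X, Y; P] ^ 2 ≤ 1 := by
  have := variance_nonneg (fun ω ↦ Y ω - cov[X, Y; P] * X ω) P
  rw [variance_sub_const_mul hX hY hX1 hY1] at this
  linarith

/-- The residual `Y - ρ X` is uncorrelated with `X` and jointly Gaussian with it, hence independent.
No density is used, so `ρ² = 1` is covered. -/
lemma map_eq_bivariateGaussian (h : HasGaussianLaw (fun ω ↦ (X ω, Y ω)) P)
    (hX0 : ∫ ω, X ω ∂P = 0) (hY0 : ∫ ω, Y ω ∂P = 0)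
    (hX1 : variance X P = 1) (hY1 : variance Y P = 1) :
    P.map (fun ω ↦ (X ω, Y ω)) = bivariateGaussian (cov[X, Y; P]) := by
  have := h.isProbabilityMeasure
  set ρ := cov[X, Y; P] with hρ
  have hX := h.fst
  have hY := h.snd
  have hN : HasGaussianLaw (fun ω ↦ (X ω, Y ω - ρ * X ω)) P :=
    h.map_fun ((ContinuousLinearMap.fst ℝ ℝ ℝ).prod
      (ContinuousLinearMap.snd ℝ ℝ ℝ - ρ • ContinuousLinearMap.fst ℝ ℝ ℝ))
  have hvar := variance_sub_const_mul hX.memLp_two hY.memLp_two hX1 hY1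
  have hcov : cov[X, fun ω ↦ Y ω - ρ * X ω; P] = 0 := by
    rw [covariance_fun_sub_right hX.memLp_two hY.memLp_two (hX.memLp_two.const_mul _),
      covariance_const_mul_right, covariance_self hX.aemeasurable, hX1, ← hρ]
    ring
  have hmean : ∫ ω, (Y ω - ρ * X ω) ∂P = 0 := by
    rw [integral_sub hY.integrable (hX.integrable.const_mul _), integral_const_mul, hX0, hY0]
    ring
  have hind := (indepFun_iff_map_prod_eq_prod_map_map hN.fst.aemeasurable
    hN.snd.aemeasurable).1 (hN.indepFun_of_covariance_eq_zero hcov)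
  rw [hN.fst.map_eq_gaussianReal, hN.snd.map_eq_gaussianReal, hX0, hX1, hmean, hvar,
    Real.toNNReal_one] at hind
  rw [bivariateGaussian, ← hind,
    AEMeasurable.map_map_of_aemeasurable (by fun_prop) hN.aemeasurable]
  congr 1
  ext ω <;> simp

end Law

lemma lintegral_bivariateGaussian_prod (ρ : ℝ) {f : ℝ × ℝ → ENNReal} (hf : Measurable f) :
    ∫⁻ p, f ((p.1.1 ^ 2 + p.2.1 ^ 2) / 2, (p.1.2 ^ 2 + p.2.2 ^ 2) / 2)
        ∂((bivariateGaussian ρ).prod (bivariateGaussian ρ)) =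
      ∫⁻ u, ∫⁻ w, f ((u.1 ^ 2 + u.2 ^ 2) / 2, (w.1 ^ 2 + w.2 ^ 2) / 2)
        ∂((gaussianReal (ρ * u.1) (1 - ρ ^ 2).toNNReal).prod
          (gaussianReal (ρ * u.2) (1 - ρ ^ 2).toNNReal))
        ∂((gaussianReal 0 1).prod (gaussianReal 0 1)) := by
  set v := (1 - ρ ^ 2).toNNReal with hv
  have hinner : ∀ u : ℝ × ℝ, ∫⁻ w, f ((u.1 ^ 2 + u.2 ^ 2) / 2, (w.1 ^ 2 + w.2 ^ 2) / 2)
        ∂((gaussianReal (ρ * u.1) v).prod (gaussianReal (ρ * u.2) v)) =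
      ∫⁻ n, f ((u.1 ^ 2 + u.2 ^ 2) / 2, ((ρ * u.1 + n.1) ^ 2 + (ρ * u.2 + n.2) ^ 2) / 2)
        ∂((gaussianReal 0 v).prod (gaussianReal 0 v)) := fun u ↦ by
    have hmap : ∀ c : ℝ, gaussianReal c v = (gaussianReal 0 v).map (c + ·) := fun c ↦ by
      rw [gaussianReal_map_const_add, zero_add]
    rw [hmap (ρ * u.1), hmap (ρ * u.2), Measure.map_prod_map _ _ (by fun_prop) (by fun_prop),
      lintegral_map (by fun_prop) (by fun_prop)]
    rfl
  simp only [hinner]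
  rw [bivariateGaussian, ← hv, Measure.map_prod_map _ _ (by fun_prop) (by fun_prop),
    lintegral_map (by fun_prop) (by fun_prop), lintegral_prod _ (by fun_prop),
    lintegral_prod _ (by fun_prop), lintegral_prod _ (by fun_prop)]
  refine lintegral_congr fun x ↦ ?_
  simp only [Prod.map]
  have h1 : ∀ n, ∫⁻ q : ℝ × ℝ, f ((x ^ 2 + q.1 ^ 2) / 2,
        ((ρ * x + n) ^ 2 + (ρ * q.1 + q.2) ^ 2) / 2) ∂((gaussianReal 0 1).prod (gaussianReal 0 v)) =
      ∫⁻ y, ∫⁻ m, f ((x ^ 2 + y ^ 2) / 2, ((ρ * x + n) ^ 2 + (ρ * y + m) ^ 2) / 2)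
        ∂(gaussianReal 0 v) ∂(gaussianReal 0 1) := fun n ↦ lintegral_prod _ (by fun_prop)
  have h2 : ∀ y, ∫⁻ n : ℝ × ℝ, f ((x ^ 2 + y ^ 2) / 2,
        ((ρ * x + n.1) ^ 2 + (ρ * y + n.2) ^ 2) / 2) ∂((gaussianReal 0 v).prod (gaussianReal 0 v)) =
      ∫⁻ n, ∫⁻ m, f ((x ^ 2 + y ^ 2) / 2, ((ρ * x + n) ^ 2 + (ρ * y + m) ^ 2) / 2)
        ∂(gaussianReal 0 v) ∂(gaussianReal 0 v) := fun n ↦ lintegral_prod _ (by fun_prop)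
  simp only [h1, h2]
  -- Only the middle two integrals differ in order: the noise of the first pair and the first
  -- coordinate of the second.
  refine lintegral_lintegral_swap (Measurable.aemeasurable ?_)
  refine Measurable.lintegral_prod_right' (f := fun p : (ℝ × ℝ) × ℝ ↦ f ((x ^ 2 + p.1.2 ^ 2) / 2,
    ((ρ * x + p.1.1) ^ 2 + (ρ * p.1.2 + p.2) ^ 2) / 2)) (by fun_prop)

lemma lintegral_bivariateGaussian_prod_moment {a b ρ : ℝ} (hρ : ρ ^ 2 ≤ 1) (ha : -1 < a)
    (hb : -1 < b) (hab : ρ ^ 2 = 1 → -1 < a + b) :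
    ∫⁻ p, ENNReal.ofReal
        (((p.1.1 ^ 2 + p.2.1 ^ 2) / 2) ^ a * ((p.1.2 ^ 2 + p.2.2 ^ 2) / 2) ^ b)
        ∂((bivariateGaussian ρ).prod (bivariateGaussian ρ)) =
      ENNReal.ofReal (Real.Gamma (1 + a) * Real.Gamma (1 + b) *
        ∑' k, risingCoeff (-a) k * risingCoeff (-b) k * (ρ ^ 2) ^ k) := by
  rw [lintegral_bivariateGaussian_prod ρ (f := fun z ↦ ENNReal.ofReal (z.1 ^ a * z.2 ^ b))
    (by fun_prop)]
  rcases hρ.lt_or_eq with h | h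
  · refine lintegral_mixed_moment ha hb ?_ (Real.coe_toNNReal _ (by linarith))
    rw [ne_eq, Real.toNNReal_eq_zero, not_le]
    linarith
  · have hΓa := Real.Gamma_pos_of_pos (show 0 < 1 + a by linarith)
    have hΓb := Real.Gamma_pos_of_pos (show 0 < 1 + b by linarith)
    -- With zero variance the conditional law is a Dirac mass at `ρ u`, which has the same norm as
    -- `u` for either sign of `ρ`.
    have hinner : ∀ u : ℝ × ℝ, ∫⁻ w, ENNReal.ofReal
        (((u.1 ^ 2 + u.2 ^ 2) / 2) ^ a * ((w.1 ^ 2 + w.2 ^ 2) / 2) ^ b)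
        ∂((gaussianReal (ρ * u.1) (1 - ρ ^ 2).toNNReal).prod
          (gaussianReal (ρ * u.2) (1 - ρ ^ 2).toNNReal)) =
        (fun x ↦ ENNReal.ofReal (x ^ a * x ^ b)) ((u.1 ^ 2 + u.2 ^ 2) / 2) := fun u ↦ by
      rw [h, sub_self, Real.toNNReal_zero, gaussianReal_zero_var, gaussianReal_zero_var,
        Measure.dirac_prod_dirac, lintegral_dirac]
      simp only [mul_pow, h, one_mul]
    rw [lintegral_congr hinner, lintegral_half_norm_sq_gaussianReal_prod_standard
      (g := fun x ↦ ENNReal.ofReal (x ^ a * x ^ b)) (by fun_prop), h]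
    simp only [one_pow, mul_one]
    rw [tsum_risingCoeff_mul_eq_gamma (hab h), mul_div_cancel₀ _ (by positivity)]
    have h1 := lintegral_rpow_mul_exp_neg_div (hab h) one_pos
    rw [Real.one_rpow, one_mul, show a + b + 1 = 1 + a + b by ring] at h1
    rw [← h1]
    refine setLIntegral_congr_fun measurableSet_Ioi fun y hy ↦ ?_
    have hy' : (0 : ℝ) < y := hy
    rw [← ENNReal.ofReal_mul (by positivity), Real.rpow_add hy', div_one]

end WeibullField

namespace WeibullField

/-! ### The Weibull process -/

lemma nu_pos {κ : ℝ} (hκ : 0 < κ) : 0 < nu κ :=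
  inv_pos.2 (Real.Gamma_pos_of_pos (by positivity))

lemma scaledChiSq_two {T Ω : Type*} (Zc : Fin 2 → T → Ω → ℝ) (s : T) (ω : Ω) :
    scaledChiSq Zc s ω = (Zc 0 s ω ^ 2 + Zc 1 s ω ^ 2) / 2 := by
  rw [scaledChiSq, Fin.sum_univ_two, Nat.cast_ofNat, add_div]

lemma weibull_rpow_mul_weibull_rpow {T Ω : Type*} (Zc : Fin 2 → T → Ω → ℝ) {κ : ℝ} (hκ : 0 < κ)
    (s₁ s₂ : T) (a b : ℝ) (ω : Ω) :
    weibull κ Zc s₁ ω ^ a * weibull κ Zc s₂ ω ^ b =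
      nu κ ^ (a + b) * (((Zc 0 s₁ ω ^ 2 + Zc 1 s₁ ω ^ 2) / 2) ^ (a / κ) *
        ((Zc 0 s₂ ω ^ 2 + Zc 1 s₂ ω ^ 2) / 2) ^ (b / κ)) := by
  have hν := nu_pos hκ
  rw [weibull, weibull, scaledChiSq_two, scaledChiSq_two,
    Real.mul_rpow hν.le (by positivity), Real.mul_rpow hν.le (by positivity),
    ← Real.rpow_mul (by positivity), ← Real.rpow_mul (by positivity), Real.rpow_add hν,
    one_div_mul_eq_div, one_div_mul_eq_div]
  ring

lemma weibull_nonneg {T Ω : Type*} (Zc : Fin 2 → T → Ω → ℝ) {κ : ℝ} (hκ : 0 < κ) (s : T)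
    (ω : Ω) : 0 ≤ weibull κ Zc s ω := by
  have := nu_pos hκ
  rw [weibull, scaledChiSq_two]
  positivity

/-! ### Convergence and positivity of the hypergeometric sums on `[0, 1]` -/

lemma summable_hypergeometric_mul_pow {a b x : ℝ} (hx0 : 0 ≤ x) (hx : x ≤ 1)
    (hab : x = 1 → a + b < 1) : Summable fun k ↦ risingCoeff a k * risingCoeff b k * x ^ k := by
  rcases hx.lt_or_eq with h | rfl
  · exact (summable_abs_risingCoeff_mul_pow a b (by rwa [abs_of_nonneg hx0])).of_abs
  · simpa using (summable_abs_risingCoeff_mul (hab rfl)).of_abs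

/-- The terms may have mixed signs, but Euler's transformation (Gauss's theorem at `x = 1`) gives a
manifestly nonnegative form. This lets `ENNReal.toReal` recover the moment without truncation. -/
lemma tsum_hypergeometric_nonneg {a b x : ℝ} (hx0 : 0 ≤ x) (hx : x ≤ 1) (ha : -1 < a)
    (hb : -1 < b) (hab : x = 1 → -1 < a + b) :
    0 ≤ ∑' k, risingCoeff (-a) k * risingCoeff (-b) k * x ^ k := by
  have ha' : 0 < 1 + a := by linarith
  have hb' : 0 < 1 + b := by linarith
  rcases hx.lt_or_eq with h | rfl
  · rw [← one_sub_rpow_mul_tsum_risingCoeff a b (by rwa [abs_of_nonneg hx0])]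
    exact mul_nonneg (Real.rpow_nonneg (by linarith) _) (tsum_nonneg fun k ↦ mul_nonneg
      (mul_pos (risingCoeff_pos ha' k) (risingCoeff_pos hb' k)).le (by positivity))
  · simp only [one_pow, mul_one]
    rw [tsum_risingCoeff_mul_eq_gamma (hab rfl)]
    have h1 := Real.Gamma_pos_of_pos (show 0 < 1 + a + b by linarith [hab rfl])
    have h2 := Real.Gamma_pos_of_pos ha'
    have h3 := Real.Gamma_pos_of_pos hb'
    positivity

lemma ordinaryHypergeometric_zero_one (a x : ℝ) : ₂F₁ a 0 1 x = 1 := by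
  rw [ordinaryHypergeometric_one_eq_tsum, tsum_eq_single 0]
  · simp
  · intro k hk
    obtain ⟨k, rfl⟩ := Nat.exists_eq_succ_of_ne_zero hk
    simp [risingCoeff_zero_left]

/-- The terms are squares, and the first two already give `1 + a²`; `2 * a < 1` ensures convergence.
-/
lemma one_lt_ordinaryHypergeometric_self_one {a : ℝ} (ha : a ≠ 0) (ha' : a < 1 / 2) :
    1 < ₂F₁ a a 1 (1 : ℝ) := by
  rw [ordinaryHypergeometric_one_eq_tsum]
  simp only [one_pow, mul_one]
  have hs : Summable fun k ↦ risingCoeff a k * risingCoeff a k :=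
    (summable_abs_risingCoeff_mul (by linarith)).of_abs
  have h := hs.sum_le_tsum (Finset.range 2) fun k _ ↦ mul_self_nonneg _
  simp only [Finset.sum_range_succ, Finset.sum_range_zero, risingCoeff_zero, risingCoeff_succ a 0]
    at h
  have h2 : 0 < a * a := mul_self_pos.2 ha
  norm_num at h
  linarith

/-! ### Finite-dimensional laws of the copies -/

section Copies

variable {T Ω₀ Ω : Type*} [MeasurableSpace Ω₀] [MeasurableSpace Ω] {P₀ : Measure Ω₀} {P : Measure Ω}
  {Z : T → Ω₀ → ℝ} {Zc : Fin 2 → T → Ω → ℝ}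

lemma IsIndependentCopies.identDistrib_prodMk (hZc : IsIndependentCopies Zc P Z P₀)
    (k : Fin 2) (s₁ s₂ : T) :
    IdentDistrib (fun ω ↦ (Zc k s₁ ω, Zc k s₂ ω)) (fun ω ↦ (Z s₁ ω, Z s₂ ω)) P P₀ := by
  classical
  have h₁ : s₁ ∈ ({s₁, s₂} : Finset T) := by simp
  have h₂ : s₂ ∈ ({s₁, s₂} : Finset T) := by simp
  exact (hZc.identDistrib k {s₁, s₂}).comp
    (u := fun z : ({s₁, s₂} : Finset T) → ℝ ↦ (z ⟨s₁, h₁⟩, z ⟨s₂, h₂⟩)) (by fun_prop)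

lemma IsIndependentCopies.aemeasurable (hZc : IsIndependentCopies Zc P Z P₀)
    (k : Fin 2) (s : T) : AEMeasurable (Zc k s) P :=
  (hZc.identDistrib_prodMk k s s).aemeasurable_fst.fst

lemma aemeasurable_weibull_rpow_mul (hZc : IsIndependentCopies Zc P Z P₀) (κ : ℝ)
    (s₁ s₂ : T) (a b : ℝ) :
    AEMeasurable (fun ω ↦ weibull κ Zc s₁ ω ^ a * weibull κ Zc s₂ ω ^ b) P := by
  have h := hZc.aemeasurable
  simp only [weibull, scaledChiSq_two]
  have h01 := h 0 s₁
  have h11 := h 1 s₁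
  have h02 := h 0 s₂
  have h12 := h 1 s₂
  fun_prop

end Copies

section Weibull

variable {E Ω₀ Ω : Type*} [AddCommGroup E] {S : Set E} [MeasurableSpace Ω₀] [MeasurableSpace Ω]
  {P₀ : Measure Ω₀} {P : Measure Ω} {ρ : E → ℝ} {Z : S → Ω₀ → ℝ} {Zc : Fin 2 → S → Ω → ℝ}

lemma IsParentProcess.memLp_two (hZ : IsParentProcess Z ρ P₀) (s : S) : MemLp (Z s) 2 P₀ :=
  hZ.hasCorrelationFunction.memLp_two s

lemma IsParentProcess.covariance_eq (hZ : IsParentProcess Z ρ P₀) (s₁ s₂ : S) :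
    cov[Z s₁, Z s₂; P₀] = ρ (s₁ - s₂) := by
  have hs : (s₂ : E) + (s₁ - s₂) = s₁ := add_sub_cancel _ _
  have h := hZ.hasCorrelationFunction.correlation_eq s₂ (s₁ - s₂) (by rw [hs]; exact s₁.2)
  rw [show (⟨s₂ + (s₁ - s₂), by rw [hs]; exact s₁.2⟩ : S) = s₁ from Subtype.ext hs, correlation,
    hZ.variance_eq_one, hZ.variance_eq_one] at h
  simpa using h

lemma IsParentProcess.correlation_zero (hZ : IsParentProcess Z ρ P₀) (s : S) : ρ 0 = 1 := by
  rw [← sub_self (s : E), ← hZ.covariance_eq s s,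
    covariance_self (hZ.memLp_two s).aestronglyMeasurable.aemeasurable, hZ.variance_eq_one]

lemma IsParentProcess.correlation_sq_le_one [IsProbabilityMeasure P₀]
    (hZ : IsParentProcess Z ρ P₀) (s₁ s₂ : S) : ρ (s₁ - s₂) ^ 2 ≤ 1 := by
  rw [← hZ.covariance_eq]
  exact covariance_sq_le_one (hZ.memLp_two _) (hZ.memLp_two _) (hZ.variance_eq_one _)
    (hZ.variance_eq_one _)

lemma IsParentProcess.map_prodMk (hZ : IsParentProcess Z ρ P₀) (s₁ s₂ : S) :
    P₀.map (fun ω ↦ (Z s₁ ω, Z s₂ ω)) = bivariateGaussian (ρ (s₁ - s₂)) := by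
  classical
  have h := (hZ.isGaussianProcess.hasGaussianLaw {s₁, s₂}).prodMk
    (X := fun (i : ({s₁, s₂} : Finset S)) ω ↦ Z i ω) ⟨s₁, by simp⟩ ⟨s₂, by simp⟩
  rw [← hZ.covariance_eq]
  exact map_eq_bivariateGaussian h (hZ.mean_eq_zero _) (hZ.mean_eq_zero _)
    (hZ.variance_eq_one _) (hZ.variance_eq_one _)

lemma IsIndependentCopies.map_prodMk [IsProbabilityMeasure P] (hZ : IsParentProcess Z ρ P₀)
    (hZc : IsIndependentCopies Zc P Z P₀) (s₁ s₂ : S) :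
    P.map (fun ω ↦ ((Zc 0 s₁ ω, Zc 0 s₂ ω), (Zc 1 s₁ ω, Zc 1 s₂ ω))) =
      (bivariateGaussian (ρ (s₁ - s₂))).prod (bivariateGaussian (ρ (s₁ - s₂))) := by
  have hind : IndepFun (fun ω ↦ (Zc 0 s₁ ω, Zc 0 s₂ ω)) (fun ω ↦ (Zc 1 s₁ ω, Zc 1 s₂ ω)) P :=
    (hZc.iIndepFun.indepFun (i := 0) (j := 1) (by decide)).comp
      (φ := fun z : S → ℝ ↦ (z s₁, z s₂)) (ψ := fun z : S → ℝ ↦ (z s₁, z s₂))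
      (by fun_prop) (by fun_prop)
  have h0 := hZc.identDistrib_prodMk 0 s₁ s₂
  have h1 := hZc.identDistrib_prodMk 1 s₁ s₂
  rw [(indepFun_iff_map_prod_eq_prod_map_map h0.aemeasurable_fst h1.aemeasurable_fst).1 hind,
    h0.map_eq, h1.map_eq, hZ.map_prodMk]

lemma lintegral_weibull_rpow_mul [IsProbabilityMeasure P₀] [IsProbabilityMeasure P]
    (hZ : IsParentProcess Z ρ P₀)
    (hZc : IsIndependentCopies Zc P Z P₀) {κ : ℝ} (hκ : 0 < κ) (s₁ s₂ : S) {a b : ℝ}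
    (ha : -κ < a) (hb : -κ < b) (hab : ρ (s₁ - s₂) ^ 2 = 1 → -κ < a + b) :
    ∫⁻ ω, ENNReal.ofReal (weibull κ Zc s₁ ω ^ a * weibull κ Zc s₂ ω ^ b) ∂P =
      ENNReal.ofReal (nu κ ^ (a + b) * (Real.Gamma (1 + a / κ) * Real.Gamma (1 + b / κ) *
        ₂F₁ (-a / κ) (-b / κ) 1 (ρ (s₁ - s₂) ^ 2))) := by
  have hν := nu_pos hκ
  have hscale : ∀ c, -κ < c → -1 < c / κ := fun c hc ↦ by
    rw [lt_div_iff₀ hκ]; linarith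
  have hm := lintegral_bivariateGaussian_prod_moment (a := a / κ) (b := b / κ)
    (hZ.correlation_sq_le_one s₁ s₂) (hscale a ha) (hscale b hb)
    (fun h ↦ by rw [← add_div]; exact hscale _ (hab h))
  rw [← hZc.map_prodMk hZ, lintegral_map' (by fun_prop)
    (((hZc.identDistrib_prodMk 0 s₁ s₂).aemeasurable_fst).prodMk
      ((hZc.identDistrib_prodMk 1 s₁ s₂).aemeasurable_fst))] at hm
  simp only [weibull_rpow_mul_weibull_rpow Zc hκ, ENNReal.ofReal_mul (Real.rpow_nonneg hν.le _)]
  rw [lintegral_const_mul' _ _ ENNReal.ofReal_ne_top, hm, ordinaryHypergeometric_one_eq_tsum,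
    neg_div, neg_div]

lemma integrable_weibull_rpow_mul [IsProbabilityMeasure P₀] [IsProbabilityMeasure P]
    (hZ : IsParentProcess Z ρ P₀)
    (hZc : IsIndependentCopies Zc P Z P₀) {κ : ℝ} (hκ : 0 < κ) (s₁ s₂ : S) {a b : ℝ}
    (ha : -κ < a) (hb : -κ < b) (hab : ρ (s₁ - s₂) ^ 2 = 1 → -κ < a + b) :
    Integrable (fun ω ↦ weibull κ Zc s₁ ω ^ a * weibull κ Zc s₂ ω ^ b) P := by
  refine ⟨(aemeasurable_weibull_rpow_mul hZc κ s₁ s₂ a b).aestronglyMeasurable, ?_⟩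
  rw [hasFiniteIntegral_iff_ofReal (.of_forall fun ω ↦ mul_nonneg
    (Real.rpow_nonneg (weibull_nonneg Zc hκ _ _) _) (Real.rpow_nonneg (weibull_nonneg Zc hκ _ _) _)),
    lintegral_weibull_rpow_mul hZ hZc hκ s₁ s₂ ha hb hab]
  exact ENNReal.ofReal_lt_top

lemma integral_weibull_rpow_mul [IsProbabilityMeasure P₀] [IsProbabilityMeasure P]
    (hZ : IsParentProcess Z ρ P₀)
    (hZc : IsIndependentCopies Zc P Z P₀) {κ : ℝ} (hκ : 0 < κ) (s₁ s₂ : S) {a b : ℝ}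
    (ha : -κ < a) (hb : -κ < b) (hab : ρ (s₁ - s₂) ^ 2 = 1 → -κ < a + b) :
    ∫ ω, weibull κ Zc s₁ ω ^ a * weibull κ Zc s₂ ω ^ b ∂P =
      Real.Gamma (1 + a / κ) * Real.Gamma (1 + b / κ) / Real.Gamma (1 + 1 / κ) ^ (a + b) *
        ₂F₁ (-a / κ) (-b / κ) 1 (ρ (s₁ - s₂) ^ 2) := by
  have hν := nu_pos hκ
  have hscale : ∀ c, -κ < c → 0 < 1 + c / κ := fun c hc ↦ by
    have : -1 < c / κ := by rw [lt_div_iff₀ hκ]; linarith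
    linarith
  have hΓa := Real.Gamma_pos_of_pos (hscale a ha)
  have hΓb := Real.Gamma_pos_of_pos (hscale b hb)
  have hF := tsum_hypergeometric_nonneg (a := a / κ) (b := b / κ) (sq_nonneg (ρ (s₁ - s₂)))
    (hZ.correlation_sq_le_one s₁ s₂) (by linarith [hscale a ha]) (by linarith [hscale b hb])
    fun h ↦ by rw [← add_div]; linarith [hscale _ (hab h)]
  rw [← neg_div, ← neg_div, ← ordinaryHypergeometric_one_eq_tsum] at hF
  rw [integral_eq_lintegral_of_nonneg_ae (.of_forall fun ω ↦ mul_nonneg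
    (Real.rpow_nonneg (weibull_nonneg Zc hκ _ _) _) (Real.rpow_nonneg (weibull_nonneg Zc hκ _ _) _))
    (aemeasurable_weibull_rpow_mul hZc κ s₁ s₂ a b).aestronglyMeasurable,
    lintegral_weibull_rpow_mul hZ hZc hκ s₁ s₂ ha hb hab, ENNReal.toReal_ofReal (by positivity), nu,
    Real.inv_rpow (Real.Gamma_nonneg_of_nonneg (by positivity))]
  ring

/-! ### Moments, variance and correlation of `W` -/

lemma integral_weibull [IsProbabilityMeasure P₀] [IsProbabilityMeasure P]
    (hZ : IsParentProcess Z ρ P₀) (hZc : IsIndependentCopies Zc P Z P₀) {κ : ℝ} (hκ : 0 < κ)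
    (s : S) : ∫ ω, weibull κ Zc s ω ∂P = 1 := by
  have h := integral_weibull_rpow_mul hZ hZc hκ s s (a := 1) (b := 0) (by linarith) (by linarith)
    fun _ ↦ by linarith
  have hΓ := Real.Gamma_pos_of_pos (show 0 < 1 + κ⁻¹ by positivity)
  simpa [ordinaryHypergeometric_zero_one, hΓ.ne'] using h

lemma integral_weibull_sq [IsProbabilityMeasure P₀] [IsProbabilityMeasure P]
    (hZ : IsParentProcess Z ρ P₀) (hZc : IsIndependentCopies Zc P Z P₀) {κ : ℝ} (hκ : 0 < κ)
    (s : S) : ∫ ω, weibull κ Zc s ω ^ 2 ∂P = Real.Gamma (1 + 2 / κ) * nu κ ^ 2 := by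
  have h := integral_weibull_rpow_mul hZ hZc hκ s s (a := 2) (b := 0) (by linarith) (by linarith)
    fun _ ↦ by linarith
  simpa [ordinaryHypergeometric_zero_one, nu, div_eq_mul_inv] using h

lemma integral_weibull_mul [IsProbabilityMeasure P₀] [IsProbabilityMeasure P]
    (hZ : IsParentProcess Z ρ P₀) (hZc : IsIndependentCopies Zc P Z P₀) {κ : ℝ} (hκ : 0 < κ)
    (s₁ s₂ : S) : ∫ ω, weibull κ Zc s₁ ω * weibull κ Zc s₂ ω ∂P =
      ₂F₁ (-1 / κ) (-1 / κ) 1 (ρ (s₁ - s₂) ^ 2) := by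
  have h := integral_weibull_rpow_mul hZ hZc hκ s₁ s₂ (a := 1) (b := 1) (by linarith)
    (by linarith) fun _ ↦ by linarith
  have hΓ := Real.Gamma_pos_of_pos (show 0 < 1 + 1 / κ by positivity)
  simp only [Real.rpow_one] at h
  rw [h, Real.rpow_add hΓ, Real.rpow_one, div_self (by positivity), one_mul]

lemma memLp_weibull_two [IsProbabilityMeasure P₀] [IsProbabilityMeasure P]
    (hZ : IsParentProcess Z ρ P₀) (hZc : IsIndependentCopies Zc P Z P₀) {κ : ℝ} (hκ : 0 < κ)
    (s : S) : MemLp (weibull κ Zc s) 2 P := by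
  have hm := aemeasurable_weibull_rpow_mul hZc κ s s 1 0
  simp only [Real.rpow_one, Real.rpow_zero, mul_one] at hm
  rw [memLp_two_iff_integrable_sq hm.aestronglyMeasurable]
  have h := integrable_weibull_rpow_mul hZ hZc hκ s s (a := 2) (b := 0) (by linarith) (by linarith)
    fun _ ↦ by linarith
  simpa using h

lemma variance_weibull [IsProbabilityMeasure P₀] [IsProbabilityMeasure P]
    (hZ : IsParentProcess Z ρ P₀) (hZc : IsIndependentCopies Zc P Z P₀) {κ : ℝ} (hκ : 0 < κ)
    (s : S) : variance (weibull κ Zc s) P = Real.Gamma (1 + 2 / κ) * nu κ ^ 2 - 1 := by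
  rw [variance_eq_sub (memLp_weibull_two hZ hZc hκ s), integral_weibull hZ hZc hκ]
  simp only [Pi.pow_apply]
  rw [integral_weibull_sq hZ hZc hκ, one_pow]

/-- Writing the second moment as the mixed moment at lag `0` makes the variance `₂F₁(-1/κ, -1/κ; 1;
1) - 1`, whose sign is visible, unlike that of the Gamma expression. -/
lemma variance_weibull_pos [IsProbabilityMeasure P₀] [IsProbabilityMeasure P]
    (hZ : IsParentProcess Z ρ P₀) (hZc : IsIndependentCopies Zc P Z P₀) {κ : ℝ} (hκ : 0 < κ)
    (s : S) : 0 < variance (weibull κ Zc s) P := by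
  rw [variance_eq_sub (memLp_weibull_two hZ hZc hκ s), integral_weibull hZ hZc hκ]
  simp only [Pi.pow_apply, pow_two (weibull _ _ _ _)]
  rw [integral_weibull_mul hZ hZc hκ, sub_self, hZ.correlation_zero s]
  have hneg : -1 / κ < 0 := div_neg_of_neg_of_pos (by norm_num) hκ
  have := one_lt_ordinaryHypergeometric_self_one hneg.ne (by linarith)
  rw [one_pow]
  linarith

lemma hasCorrelationFunction_weibull [IsProbabilityMeasure P₀] [IsProbabilityMeasure P]
    (hZ : IsParentProcess Z ρ P₀) (hZc : IsIndependentCopies Zc P Z P₀) {κ : ℝ} (hκ : 0 < κ) :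
    HasCorrelationFunction (weibull κ Zc)
      (fun h ↦ nu κ ^ (-2 : ℤ) / (Real.Gamma (1 + 2 / κ) - nu κ ^ (-2 : ℤ)) *
        (₂F₁ (-1 / κ) (-1 / κ) 1 (ρ h ^ 2) - 1)) P where
  memLp_two := memLp_weibull_two hZ hZc hκ
  variance_pos := variance_weibull_pos hZ hZc hκ
  correlation_eq s h hs := by
    have hν := nu_pos hκ
    have hpos := variance_weibull_pos hZ hZc hκ s
    rw [correlation, covariance_eq_sub (memLp_weibull_two hZ hZc hκ _)
      (memLp_weibull_two hZ hZc hκ _), integral_weibull hZ hZc hκ, integral_weibull hZ hZc hκ]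
    simp only [Pi.mul_apply]
    rw [integral_weibull_mul hZ hZc hκ, variance_weibull hZ hZc hκ, variance_weibull hZ hZc hκ]
    rw [variance_weibull hZ hZc hκ] at hpos
    rw [Real.mul_self_sqrt hpos.le, add_sub_cancel_left, zpow_neg, zpow_ofNat, mul_one]
    have hd : Real.Gamma (1 + 2 / κ) - (nu κ ^ 2)⁻¹ =
        (Real.Gamma (1 + 2 / κ) * nu κ ^ 2 - 1) * (nu κ ^ 2)⁻¹ := by
      field_simp
    rw [hd]
    field_simp

end Weibull

end WeibullField

theorem proposition1 {E Ω₀ Ω : Type*} [AddCommGroup E] {S : Set E}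
    [MeasurableSpace Ω₀] [MeasurableSpace Ω]
    (P₀ : Measure Ω₀) [IsProbabilityMeasure P₀] (P : Measure Ω) [IsProbabilityMeasure P]
    (ρ : E → ℝ) (Z : S → Ω₀ → ℝ) (hZ : WeibullField.IsParentProcess Z ρ P₀)
    (Zc : Fin 2 → S → Ω → ℝ) (hZc : WeibullField.IsIndependentCopies Zc P Z P₀)
    (κ : ℝ) (hκ : 0 < κ) :
    (∀ (s₁ s₂ : S) (a b : ℝ), -κ < a → -κ < b → (ρ (s₁ - s₂) ^ 2 = 1 → -κ < a + b) →
      Integrable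
        (fun ω ↦ WeibullField.weibull κ Zc s₁ ω ^ a * WeibullField.weibull κ Zc s₂ ω ^ b) P ∧
      Summable
        (fun k : ℕ ↦ ordinaryHypergeometricCoefficient (-a / κ) (-b / κ) 1 k *
          (ρ (s₁ - s₂) ^ 2) ^ k) ∧
      ∫ ω, WeibullField.weibull κ Zc s₁ ω ^ a * WeibullField.weibull κ Zc s₂ ω ^ b ∂P =
        Real.Gamma (1 + a / κ) * Real.Gamma (1 + b / κ) / Real.Gamma (1 + 1 / κ) ^ (a + b) *
          ₂F₁ (-a / κ) (-b / κ) 1 (ρ (s₁ - s₂) ^ 2)) ∧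
    WeibullField.HasCorrelationFunction (WeibullField.weibull κ Zc)
      (fun h ↦ WeibullField.nu κ ^ (-2 : ℤ) /
        (Real.Gamma (1 + 2 / κ) - WeibullField.nu κ ^ (-2 : ℤ)) *
          (₂F₁ (-1 / κ) (-1 / κ) 1 (ρ h ^ 2) - 1)) P := by
  refine ⟨fun s₁ s₂ a b ha hb hab ↦
    ⟨WeibullField.integrable_weibull_rpow_mul hZ hZc hκ s₁ s₂ ha hb hab, ?_,
      WeibullField.integral_weibull_rpow_mul hZ hZc hκ s₁ s₂ ha hb hab⟩,
    WeibullField.hasCorrelationFunction_weibull hZ hZc hκ⟩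
  simp only [WeibullField.ordinaryHypergeometricCoefficient_one]
  refine WeibullField.summable_hypergeometric_mul_pow (sq_nonneg _)
    (hZ.correlation_sq_le_one s₁ s₂) fun h ↦ ?_
  rw [← add_div, div_lt_one hκ]
  linarith [hab h]
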